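/- Let $\mathcal M$ and $\mathcal N$ be von Neumann algebras equipped with normal, faithful, tracial states $\tau$ and $\chi$, respectively. Suppose that $\mathcal M$ is generated, as a von Neumann algebra, by self-adjoint elements $X_1,\dots,X_k$, and that $\mathcal N$ is generated, as a von Neumann algebra, by self-adjoint elements $Y_1,\dots,Y_k$. Let $c<d$ be real numbers. Suppose that for every integer $n\ge 1$ and all self-adjoint $a_1,\dots,a_k\in\mathbb M_n(\mathbb C)$ whose spectra are contained in $[c,d]$, the distributions of $\sum_{i=1}^k a_i\otimes X_i$ with respect to $\mathrm{tr}_n\otimes\tau$ and of $\sum_{i=1}^k a_i\otimes Y_i$ with respect to $\mathrm{tr}_n\otimes\chi$ are the same, that is, $$(\mathrm{tr}_n\otimes\tau)\Big(\big(\textstyle\sum_i a_i\otimes X_i\big)^p\Big)=(\mathrm{tr}_n\otimes\chi)\Big(\big(\textstyle\sum_i a_i\otimes Y_i\big)^p\Big)\qquad\text{for all integers }p\ge 0,$$ where $\mathrm{tr}_n=\frac1n\mathrm{Tr}$ is the normalized trace on $\mathbb M_n(\mathbb C)$. Then there exists a $*$-isomorphism $\phi:\mathcal M\to\mathcal N$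 such that $\phi(X_i)=Y_i$ for all $i$ and $\chi\circ\phi=\tau$. -/

import Mathlib

open scoped TensorProduct

namespace FiniteVN

noncomputable section

universe u

section

variable {H : Type u} [NormedAddCommGroup H] [InnerProductSpace ℂ H] [CompleteSpace H]

/-- The ultraweak (σ-weak) topology on the bounded operators on a Hilbert space `H`: the coarsest
topology that makes all the functionals `x ↦ ∑ₙ ⟪ξₙ, x ηₙ⟫` continuous, where `ξ` and `η` are
square summable sequences of vectors of `H` (for which the series converges absolutely). -/
@[reducible]
def ultraweakTopology (H : Type u) [NormedAddCommGroup H] [InnerProductSpace ℂ H]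
    [CompleteSpace H] : TopologicalSpace (H →L[ℂ] H) :=
  TopologicalSpace.induced
    (fun (x : H →L[ℂ] H) (p : lp (fun _ : ℕ => H) 2 × lp (fun _ : ℕ => H) 2) =>
      ∑' n : ℕ, inner ℂ (p.1 n) (x (p.2 n)))
    Pi.topologicalSpace

/-- A linear functional on a von Neumann algebra is normal if it is continuous for the ultraweak
topology (restricted to the algebra). -/
def IsNormal (M : VonNeumannAlgebra H) (τ : M.toStarSubalgebra →ₗ[ℂ] ℂ) : Prop :=
  @Continuous M.toStarSubalgebra ℂ
    (TopologicalSpace.induced Subtype.val (ultraweakTopology H)) inferInstance τ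

open scoped ComplexOrder in
/-- `τ` is a normal, faithful, tracial state on the von Neumann algebra `M`. -/
structure IsFaithfulNormalTrace (M : VonNeumannAlgebra H)
    (τ : M.toStarSubalgebra →ₗ[ℂ] ℂ) : Prop where
  map_one : τ 1 = 1
  nonneg : ∀ x, 0 ≤ τ (star x * x)
  faithful : ∀ x, τ (star x * x) = 0 → x = 0
  tracial : ∀ x y, τ (x * y) = τ (y * x)
  normal : IsNormal M τ

/-- The von Neumann algebra `M` is generated by the family `X` of its elements: it is the smallest
von Neumann algebra (on the same Hilbert space) that contains them. -/
def IsGeneratedBy (M : VonNeumannAlgebra H) {ι : Type*} (X : ι → M.toStarSubalgebra) : Prop :=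
  IsLeast {S : VonNeumannAlgebra H | ∀ i, (X i : H →L[ℂ] H) ∈ S} M

end

/-- The distribution of an element `b` of a noncommutative probability space `(A, φ)`, given by its
moments: the linear functional `p ↦ φ (p(b))` on `ℂ[x]`. -/
def distribution {A : Type*} [Ring A] [Algebra ℂ A] (φ : A →ₗ[ℂ] ℂ) (b : A) :
    Polynomial ℂ →ₗ[ℂ] ℂ :=
  φ ∘ₗ (Polynomial.aeval b).toLinearMap

/-- The normalized trace `tr = (1/n) Tr` on the `n × n` complex matrices. -/
def normTr (n : ℕ) : Matrix (Fin n) (Fin n) ℂ →ₗ[ℂ] ℂ :=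
  (n : ℂ)⁻¹ • Matrix.traceLinearMap (Fin n) ℂ ℂ

/-- The functional `tr ⊗ τ` on `𝕄ₙ(ℂ) ⊗ A`. -/
def trTensor (n : ℕ) {A : Type*} [Ring A] [Algebra ℂ A] (τ : A →ₗ[ℂ] ℂ) :
    Matrix (Fin n) (Fin n) ℂ ⊗[ℂ] A →ₗ[ℂ] ℂ :=
  LinearMap.mul' ℂ ℂ ∘ₗ TensorProduct.map (normTr n) τ

end

end FiniteVN

/-!
The proof has two independent halves.

*Mixed moments.* Expanding `(tr ⊗ τ)((∑ᵢ aᵢ ⊗ Xᵢ)ᵖ)` shows that it is a polynomial in the entries of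
the `aᵢ`. The self-adjoint tuples with spectra in `[c, d]` contain a real neighbourhood of a tuple
of scalar matrices, so equality of the moments there implies equality for all complex matrices
(`moment_eq_of_spectrum_subset`). For a word `w` of length `p`, let `aᵢ` be the sum of the matrix
units `e_{j,j+1}`, indices modulo `p`, over the `j` with `w j = i`. The pencil is then a weighted
cyclic shift; its `p`-th power is diagonal with the rotations of the word as entries, so its
moment is the trace of the word (`trTensor_cyclicShift_pow`). Hence `τ` and `χ` agree on
corresponding words in the `Xᵢ` and the `Yᵢ` (`trace_word_eq`).

*From moments to the isomorphism.* Write `‖x‖₂ = τ(x⋆x)^{1/2}`. The star algebra `P` generated by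
the pairs `(Xᵢ, Yᵢ)` in `M × N` is the graph of a trace-preserving map, and so is its closure `G`
in the `2`-norm, which is a C⋆-algebra. Two facts about von Neumann algebras enter.

* The star algebra of the generators is `2`-norm dense, by the double commutant theorem on
  `ℓ²(ℕ; H)` and normality of the trace (`IsGeneratedBy.exists_traceNorm_sub_lt`).
* The unit ball is complete in the `2`-norm, by its weak compactness and normality of the trace
  (`IsFaithfulNormalTrace.isTraceComplete`).

To see that the coordinate projection `G → M` is onto, approximate a self-adjoint `b` in `2`-norm by
first coordinates of self-adjoint elements of `P`. These need not be bounded in norm, but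
their resolvents at `-i` are contractions that converge in `2`-norm to `(b + i)⁻¹`, and the
resolvents in the second coordinate converge as well, because the unit ball is complete. So
`(b + i)⁻¹` is a first coordinate of `G`. As the projection is an injective homomorphism of
C⋆-algebras, its range is closed and, by spectral permanence, contains `b`
(`exists_mem_graph`). This takes the place of Kaplansky's density theorem. By symmetry both
projections of `G` are isomorphisms, and the isomorphism of the theorem is the composite of one
with the inverse of the other (`exists_starAlgEquiv_of_dense`).
-/

namespace FiniteVN

noncomputable section

universe u v w

/-! ### The `2`-norm of a positive trace -/

section TraceNorm

open scoped ComplexOrder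

variable {A : Type u} [CStarAlgebra A]

/-- A positive tracial functional on a C⋆-algebra; neither faithfulness nor normalization is
required. -/
structure IsPositiveTrace (τ : A →ₗ[ℂ] ℂ) : Prop where
  nonneg : ∀ x, 0 ≤ τ (star x * x)
  tracial : ∀ x y, τ (x * y) = τ (y * x)

/-- The seminorm `‖x‖₂ = τ(x⋆x)^{1/2}` given by a positive functional `τ`. -/
def traceNorm (τ : A →ₗ[ℂ] ℂ) (x : A) : ℝ := √(τ (star x * x)).re

namespace IsPositiveTrace

variable {τ : A →ₗ[ℂ] ℂ}

/-- The GNS space of the functional realizes `traceNorm τ` as the seminorm of a pre-inner product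
space, so that the triangle and Cauchy–Schwarz inequalities need no separate proof. -/
theorem exists_gns (hτ : IsPositiveTrace τ) :
    ∃ (V : Type u) (_ : SeminormedAddCommGroup V) (_ : InnerProductSpace ℂ V) (ι : A →ₗ[ℂ] V),
      (∀ x, traceNorm τ x = ‖ι x‖) ∧ (∀ x y, inner ℂ (ι x) (ι y) = τ (star x * y)) ∧
      ∀ a x, ‖ι (a * x)‖ ≤ ‖a‖ * ‖ι x‖ := by
  let _ := CStarAlgebra.spectralOrder A
  have := CStarAlgebra.spectralOrderedRing A
  let f : A →ₚ[ℂ] ℂ := PositiveLinearMap.mk₀ τ (by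
    intro a ha
    obtain ⟨x, rfl⟩ := CStarAlgebra.nonneg_iff_eq_star_mul_self.mp ha
    exact hτ.nonneg x)
  refine ⟨f.PreGNS, inferInstance, inferInstance, f.toPreGNS.toLinearMap, fun x => rfl,
    fun x y => rfl, fun a x => ?_⟩
  have h1 := (f.leftMulMapPreGNS a).le_opNorm (f.toPreGNS x)
  have h2 : ‖f.leftMulMapPreGNS a‖ ≤ ‖a‖ :=
    LinearMap.mkContinuous_norm_le _ (norm_nonneg _) _
  calc _ ≤ _ := h1
    _ ≤ _ := by gcongr; rfl

theorem traceNorm_nonneg (τ : A →ₗ[ℂ] ℂ) (x : A) : 0 ≤ traceNorm τ x := Real.sqrt_nonneg _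

theorem apply_star_mul_self (hτ : IsPositiveTrace τ) (x : A) :
    τ (star x * x) = ((traceNorm τ x ^ 2 : ℝ) : ℂ) := by
  have h := hτ.nonneg x
  rw [Complex.le_def] at h
  simp only [Complex.zero_re, Complex.zero_im] at h
  rw [traceNorm, Real.sq_sqrt h.1]
  exact Complex.ext (by simp) (by simp [← h.2])

theorem traceNorm_add_le (hτ : IsPositiveTrace τ) (x y : A) :
    traceNorm τ (x + y) ≤ traceNorm τ x + traceNorm τ y := by
  obtain ⟨V, _, _, ι, h, -, -⟩ := hτ.exists_gns
  simpa only [h, map_add] using norm_add_le (ι x) (ι y)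

theorem traceNorm_smul (hτ : IsPositiveTrace τ) (c : ℂ) (x : A) :
    traceNorm τ (c • x) = ‖c‖ * traceNorm τ x := by
  obtain ⟨V, _, _, ι, h, -, -⟩ := hτ.exists_gns
  simpa only [h, map_smul] using norm_smul c (ι x)

theorem traceNorm_neg (τ : A →ₗ[ℂ] ℂ) (x : A) : traceNorm τ (-x) = traceNorm τ x := by
  simp [traceNorm]

theorem traceNorm_sub_comm (τ : A →ₗ[ℂ] ℂ) (x y : A) :
    traceNorm τ (x - y) = traceNorm τ (y - x) := by
  rw [← traceNorm_neg, neg_sub]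

theorem traceNorm_zero (τ : A →ₗ[ℂ] ℂ) : traceNorm τ 0 = 0 := by simp [traceNorm]

theorem traceNorm_sub_le_add (hτ : IsPositiveTrace τ) (x y z : A) :
    traceNorm τ (x - z) ≤ traceNorm τ (x - y) + traceNorm τ (y - z) := by
  simpa using hτ.traceNorm_add_le (x - y) (y - z)

theorem traceNorm_star (hτ : IsPositiveTrace τ) (x : A) :
    traceNorm τ (star x) = traceNorm τ x := by
  rw [traceNorm, traceNorm, star_star, hτ.tracial]

theorem traceNorm_mul_le (hτ : IsPositiveTrace τ) (a x : A) :
    traceNorm τ (a * x) ≤ ‖a‖ * traceNorm τ x := by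
  obtain ⟨V, _, _, ι, h, -, h'⟩ := hτ.exists_gns
  simpa only [h] using h' a x

theorem traceNorm_mul_le' (hτ : IsPositiveTrace τ) (x a : A) :
    traceNorm τ (x * a) ≤ traceNorm τ x * ‖a‖ := by
  rw [← hτ.traceNorm_star, star_mul, mul_comm, ← norm_star a, ← hτ.traceNorm_star x]
  exact hτ.traceNorm_mul_le _ _

theorem norm_apply_star_mul_le (hτ : IsPositiveTrace τ) (x y : A) :
    ‖τ (star x * y)‖ ≤ traceNorm τ x * traceNorm τ y := by
  obtain ⟨V, _, _, ι, h, h', -⟩ := hτ.exists_gns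
  simpa only [h, h'] using norm_inner_le_norm (𝕜 := ℂ) (ι x) (ι y)

theorem norm_apply_le (hτ : IsPositiveTrace τ) (x : A) :
    ‖τ x‖ ≤ traceNorm τ 1 * traceNorm τ x := by
  simpa using hτ.norm_apply_star_mul_le 1 x

theorem traceNorm_le (hτ : IsPositiveTrace τ) (x : A) :
    traceNorm τ x ≤ ‖x‖ * traceNorm τ 1 := by
  simpa using hτ.traceNorm_mul_le x 1

end IsPositiveTrace

end TraceNorm

/-! ### Extension of trace-preserving maps to the `2`-norm closure -/

section Resolvent

variable {A : Type u} [CStarAlgebra A]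

theorem isUnit_add_I_smul_one {b : A} (hb : IsSelfAdjoint b) :
    IsUnit (b + Complex.I • (1 : A)) := by
  have h : (-Complex.I) ∉ spectrum ℂ b := fun h => by
    have := hb.im_eq_zero_of_mem_spectrum h
    simp at this
  rw [spectrum.notMem_iff] at h
  have h' := h.neg
  rwa [Algebra.algebraMap_eq_smul_one, neg_sub, neg_smul, sub_neg_eq_add] at h'

/-- The resolvent of a self-adjoint element at `-i` is a contraction. -/
theorem norm_le_one_of_add_I_smul_one_mul {b r : A} (hb : IsSelfAdjoint b)
    (h : (b + Complex.I • (1 : A)) * r = 1) : ‖r‖ ≤ 1 := by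
  let _ := CStarAlgebra.spectralOrder A
  have := CStarAlgebra.spectralOrderedRing A
  have h1 : star r * r + star (b * r) * (b * r) = 1 := by
    have h2 : star ((b + Complex.I • (1 : A)) * r) * ((b + Complex.I • (1 : A)) * r) = 1 := by
      simp [h]
    have hs : star (b + Complex.I • (1 : A)) = b - Complex.I • (1 : A) := by
      simp [hb.star_eq, sub_eq_add_neg]
    rw [star_mul, hs] at h2
    rw [← h2, star_mul, hb.star_eq]
    have h3 : (b - Complex.I • (1 : A)) * (b + Complex.I • (1 : A)) = b * b + 1 := by
      simp [sub_mul, mul_add, smul_sub, smul_smul]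
      abel
    calc _ = star r * (b * b + 1) * r := by noncomm_ring
      _ = star r * ((b - Complex.I • (1 : A)) * (b + Complex.I • (1 : A))) * r := by rw [h3]
      _ = _ := by simp only [mul_assoc]
  have h4 : star r * r ≤ 1 := by
    rw [← h1]
    exact le_add_of_nonneg_right (star_mul_self_nonneg _)
  have h5 : ‖star r * r‖ ≤ 1 :=
    (CStarAlgebra.norm_le_one_iff_of_nonneg _ (star_mul_self_nonneg _)).mpr h4
  rw [CStarRing.norm_star_mul_self] at h5
  nlinarith [norm_nonneg r]

/-- A closed star subalgebra contains the inverses of its invertible elements (spectral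
permanence). -/
theorem mem_of_mul_eq_one {S : StarSubalgebra ℂ A} (hS : IsClosed (S : Set A)) {x y : A}
    (hx : x ∈ S) (hxy : x * y = 1) (hyx : y * x = 1) : y ∈ S := by
  have : IsClosed (S : Set A) := hS
  have hu : IsUnit (⟨x, hx⟩ : S) := (StarSubalgebra.coe_isUnit S).mp ⟨⟨x, y, hxy, hyx⟩, rfl⟩
  obtain ⟨z, hz⟩ := hu.exists_right_inv
  have hz' : x * (z : A) = 1 := congrArg Subtype.val hz
  rw [left_inv_eq_right_inv hyx hz']
  exact z.2

theorem exists_resolvent_mem {S : StarSubalgebra ℂ A} (hS : IsClosed (S : Set A)) {b : A}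
    (hb : IsSelfAdjoint b) (hbS : b ∈ S) :
    ∃ r ∈ S, (b + Complex.I • (1 : A)) * r = 1 ∧ r * (b + Complex.I • (1 : A)) = 1 := by
  obtain ⟨z, hz⟩ := isUnit_add_I_smul_one hb
  have h1 : (b + Complex.I • (1 : A)) * (z⁻¹ : Aˣ) = 1 := by rw [← hz]; simp
  have h2 : (z⁻¹ : Aˣ) * (b + Complex.I • (1 : A)) = 1 := by rw [← hz]; simp
  exact ⟨_, mem_of_mul_eq_one hS (S.add_mem hbS (S.smul_mem S.one_mem _)) h1 h2, h1, h2⟩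

end Resolvent

section TraceClosure

variable {E : Type u} [CStarAlgebra E]

open IsPositiveTrace

/-- The closure of a star subalgebra in the seminorm `traceNorm T` of a positive trace `T`. It is
again a star subalgebra because multiplication by a fixed element is bounded for this seminorm. -/
def traceClosure {T : E →ₗ[ℂ] ℂ} (hT : IsPositiveTrace T) (P : StarSubalgebra ℂ E) :
    StarSubalgebra ℂ E where
  carrier := {g | ∀ ε > 0, ∃ p ∈ P, traceNorm T (g - p) < ε}
  add_mem' := by
    intro x y hx hy ε hε
    obtain ⟨p, hp, h⟩ := hx (ε / 2) (half_pos hε)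
    obtain ⟨q, hq, h'⟩ := hy (ε / 2) (half_pos hε)
    refine ⟨p + q, P.add_mem hp hq, ?_⟩
    have := hT.traceNorm_add_le (x - p) (y - q)
    rw [add_sub_add_comm]
    linarith
  mul_mem' := by
    intro x y hx hy ε hε
    -- `x y - p q = x (y - q) + (x - p) q`, with `p` chosen after `q`
    obtain ⟨q, hq, h⟩ := hy (ε / 2 / (‖x‖ + 1)) (by positivity)
    obtain ⟨p, hp, h'⟩ := hx (ε / 2 / (‖q‖ + 1)) (by positivity)
    refine ⟨p * q, P.mul_mem hp hq, ?_⟩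
    have h1 := hT.traceNorm_mul_le x (y - q)
    have h2 := hT.traceNorm_mul_le' (x - p) q
    have h3 := hT.traceNorm_add_le (x * (y - q)) ((x - p) * q)
    rw [lt_div_iff₀ (by positivity)] at h h'
    have h4 := traceNorm_nonneg T (y - q)
    have h5 := traceNorm_nonneg T (x - p)
    have h6 : x * y - p * q = x * (y - q) + (x - p) * q := by noncomm_ring
    rw [h6]
    nlinarith
  algebraMap_mem' := fun c ε hε => ⟨_, P.algebraMap_mem c, by simpa [traceNorm_zero] using hε⟩
  star_mem' := by
    intro x hx ε hε
    obtain ⟨p, hp, h⟩ := hx ε hε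
    exact ⟨star p, star_mem hp, by rwa [← star_sub, hT.traceNorm_star]⟩

variable {T : E →ₗ[ℂ] ℂ} (hT : IsPositiveTrace T) (P : StarSubalgebra ℂ E)

theorem subset_traceClosure {p : E} (hp : p ∈ P) : p ∈ traceClosure hT P :=
  fun ε hε => ⟨p, hp, by simpa [traceNorm_zero] using hε⟩

theorem mem_traceClosure_of_approx {g : E}
    (h : ∀ ε > 0, ∃ p ∈ traceClosure hT P, traceNorm T (g - p) < ε) : g ∈ traceClosure hT P := by
  intro ε hε
  obtain ⟨q, hq, h1⟩ := h (ε / 2) (half_pos hε)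
  obtain ⟨p, hp, h2⟩ := hq (ε / 2) (half_pos hε)
  exact ⟨p, hp, by linarith [hT.traceNorm_sub_le_add g q p]⟩

theorem isClosed_traceClosure : IsClosed (traceClosure hT P : Set E) := by
  refine isClosed_of_closure_subset fun g hg => mem_traceClosure_of_approx hT P fun ε hε => ?_
  obtain ⟨p, hp, h⟩ := Metric.mem_closure_iff.mp hg (ε / (traceNorm T 1 + 1))
    (div_pos hε (by linarith [traceNorm_nonneg T 1]))
  refine ⟨p, hp, ?_⟩
  have h1 := traceNorm_nonneg T 1
  rw [dist_eq_norm, lt_div_iff₀ (by linarith)] at h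
  have := hT.traceNorm_le (g - p)
  nlinarith [norm_nonneg (g - p)]

end TraceClosure

section Extension

open Filter Topology

/-- The unit ball of the C⋆-algebra is complete for the seminorm `traceNorm τ`. -/
def IsTraceComplete {A : Type u} [CStarAlgebra A] (τ : A →ₗ[ℂ] ℂ) : Prop :=
  ∀ x : ℕ → A, (∀ n, ‖x n‖ ≤ 1) →
    (∀ ε > 0, ∃ N, ∀ m ≥ N, ∀ n ≥ N, traceNorm τ (x m - x n) < ε) →
    ∃ y, ∀ ε > 0, ∃ N, ∀ n ≥ N, traceNorm τ (x n - y) < ε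

variable {A : Type u} {B : Type v} {E : Type w} [CStarAlgebra A] [CStarAlgebra B] [CStarAlgebra E]
  {τ : A →ₗ[ℂ] ℂ} {χ : B →ₗ[ℂ] ℂ}

theorem traceNorm_eq_of_trace_eq {π₁ : E →⋆ₐ[ℂ] A} {π₂ : E →⋆ₐ[ℂ] B} {G : StarSubalgebra ℂ E}
    (h : ∀ g ∈ G, τ (π₁ g) = χ (π₂ g)) {g : E} (hg : g ∈ G) :
    traceNorm τ (π₁ g) = traceNorm χ (π₂ g) := by
  have := h _ (mul_mem (star_mem hg) hg)
  rw [traceNorm, traceNorm, ← map_star, ← map_mul, this, map_mul, map_star]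

/-- Let `G ⊆ E` play the role of the graph of a trace-preserving partial map from `A` to `B`, with
coordinates `π₁` and `π₂`. If it is closed for the `2`-seminorms and its domain is dense for the
`2`-seminorm, then its domain contains the resolvent of every self-adjoint `b`: resolvents are
contractions and depend continuously on `b` in the `2`-seminorm, so the completeness of the unit
ball of `B` provides a partner. -/
theorem exists_mem_graph_resolvent (π₁ : E →⋆ₐ[ℂ] A) (π₂ : E →⋆ₐ[ℂ] B)
    (hE : ∀ a b, ∃ e, π₁ e = a ∧ π₂ e = b)
    (hτ : IsPositiveTrace τ) (hχc : IsTraceComplete χ)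
    (G : StarSubalgebra ℂ E) (hGc : IsClosed (G : Set E))
    (hG : ∀ g ∈ G, τ (π₁ g) = χ (π₂ g))
    (hGt : ∀ e, (∀ ε > 0, ∃ g ∈ G, traceNorm τ (π₁ e - π₁ g) < ε ∧
      traceNorm χ (π₂ e - π₂ g) < ε) → e ∈ G)
    (hd : ∀ a, ∀ ε > 0, ∃ g ∈ G, traceNorm τ (a - π₁ g) < ε)
    {b r : A} (hb : IsSelfAdjoint b) (hbr : (b + Complex.I • (1 : A)) * r = 1) :
    ∃ g ∈ G, π₁ g = r := by
  have hsa : ∀ ε > 0, ∃ g ∈ G, IsSelfAdjoint g ∧ traceNorm τ (b - π₁ g) < ε := by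
    intro ε hε
    obtain ⟨g, hg, h⟩ := hd b ε hε
    refine ⟨(1 / 2 : ℂ) • (g + star g), G.smul_mem (add_mem hg (star_mem hg)) _, ?_, ?_⟩
    · rw [IsSelfAdjoint, star_smul, star_add, star_star, add_comm]; simp
    · have h1 : b - π₁ ((1 / 2 : ℂ) • (g + star g)) =
          (1 / 2 : ℂ) • ((b - π₁ g) + star (b - π₁ g)) := by
        rw [star_sub, hb.star_eq, map_smul, map_add, map_star]
        module
      rw [h1, hτ.traceNorm_smul]
      have h2 := hτ.traceNorm_add_le (b - π₁ g) (star (b - π₁ g))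
      rw [hτ.traceNorm_star] at h2
      have h3 : ‖(1 / 2 : ℂ)‖ = 1 / 2 := by norm_num
      rw [h3]
      linarith
  choose g hgG hgs hgb using fun n : ℕ => hsa (1 / ((n : ℝ) + 1)) Nat.one_div_pos_of_nat
  choose R hRG hR1 hR2 using fun n => exists_resolvent_mem hGc (hgs n) (hgG n)
  have hRn : ∀ n, ‖R n‖ ≤ 1 := fun n => norm_le_one_of_add_I_smul_one_mul (hgs n) (hR1 n)
  have hr : ‖r‖ ≤ 1 := norm_le_one_of_add_I_smul_one_mul hb hbr
  have hconv : ∀ n, traceNorm τ (π₁ (R n) - r) ≤ 1 / ((n : ℝ) + 1) := by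
    intro n
    have h1 : π₁ (R n) * (π₁ (g n) + Complex.I • (1 : A)) = 1 := by
      simpa using congrArg π₁ (hR2 n)
    have h2 : π₁ (R n) - r = π₁ (R n) * ((b - π₁ (g n)) * r) := by
      calc π₁ (R n) - r = π₁ (R n) * ((b + Complex.I • (1 : A)) * r) -
            π₁ (R n) * (π₁ (g n) + Complex.I • (1 : A)) * r := by rw [hbr, h1]; simp
        _ = _ := by noncomm_ring
    rw [h2]
    have h3 : ‖π₁ (R n)‖ ≤ 1 := (NonUnitalStarAlgHom.norm_apply_le π₁ (R n)).trans (hRn n)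
    have h4 := hτ.traceNorm_mul_le (π₁ (R n)) ((b - π₁ (g n)) * r)
    have h5 := hτ.traceNorm_mul_le' (b - π₁ (g n)) r
    have h6 := IsPositiveTrace.traceNorm_nonneg τ (b - π₁ (g n))
    have h7 := IsPositiveTrace.traceNorm_nonneg τ ((b - π₁ (g n)) * r)
    have h8 := (hgb n).le
    nlinarith
  have hsmall : ∀ ε > 0, ∃ N : ℕ, ∀ n ≥ N, traceNorm τ (π₁ (R n) - r) < ε := by
    intro ε hε
    obtain ⟨N, hN⟩ := exists_nat_one_div_lt hε
    refine ⟨N, fun n hn => (hconv n).trans_lt (lt_of_le_of_lt ?_ hN)⟩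
    gcongr
  obtain ⟨s, hs⟩ := hχc (fun n => π₂ (R n))
    (fun n => (NonUnitalStarAlgHom.norm_apply_le π₂ (R n)).trans (hRn n)) (by
      intro ε hε
      obtain ⟨N, hN⟩ := hsmall (ε / 2) (half_pos hε)
      refine ⟨N, fun m hm n hn => ?_⟩
      rw [← map_sub, ← traceNorm_eq_of_trace_eq hG (G.sub_mem (hRG m) (hRG n)), map_sub]
      have h1 := hτ.traceNorm_sub_le_add (π₁ (R m)) r (π₁ (R n))
      rw [IsPositiveTrace.traceNorm_sub_comm τ r] at h1
      linarith [hN m hm, hN n hn])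
  obtain ⟨e, rfl, rfl⟩ := hE r s
  refine ⟨e, hGt e fun ε hε => ?_, rfl⟩
  obtain ⟨N, hN⟩ := hsmall ε hε
  obtain ⟨N', hN'⟩ := hs ε hε
  refine ⟨R (max N N'), hRG _, ?_, ?_⟩
  · rw [IsPositiveTrace.traceNorm_sub_comm]
    exact hN _ (le_max_left _ _)
  · rw [IsPositiveTrace.traceNorm_sub_comm]
    exact hN' _ (le_max_right _ _)

/-- Under the same hypotheses, if moreover the second coordinate is a function of the first, then
the domain of the graph is all of `A`. Indeed the domain is a C⋆-subalgebra, so with the resolvent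
of `b` it contains `b`. -/
theorem exists_mem_graph (π₁ : E →⋆ₐ[ℂ] A) (π₂ : E →⋆ₐ[ℂ] B)
    (hE : ∀ a b, ∃ e, π₁ e = a ∧ π₂ e = b)
    (hτ : IsPositiveTrace τ) (hχc : IsTraceComplete χ)
    (G : StarSubalgebra ℂ E) (hGc : IsClosed (G : Set E))
    (hG : ∀ g ∈ G, τ (π₁ g) = χ (π₂ g))
    (hGt : ∀ e, (∀ ε > 0, ∃ g ∈ G, traceNorm τ (π₁ e - π₁ g) < ε ∧
      traceNorm χ (π₂ e - π₂ g) < ε) → e ∈ G)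
    (hd : ∀ a, ∀ ε > 0, ∃ g ∈ G, traceNorm τ (a - π₁ g) < ε)
    (hinj : ∀ g ∈ G, π₁ g = 0 → g = 0) (a : A) : ∃ g ∈ G, π₁ g = a := by
  have : IsClosed (G : Set E) := hGc
  let f : G →⋆ₐ[ℂ] A := π₁.comp G.subtype
  have hf : Function.Injective f := (injective_iff_map_eq_zero f).mpr fun g hg =>
    Subtype.ext (hinj g g.2 hg)
  have hcl : IsClosed (f.range : Set A) := by
    have h1 : Isometry f := NonUnitalStarAlgHom.isometry f hf
    have h2 := h1.isClosedEmbedding.isClosed_range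
    exact h2
  have key : ∀ b : A, IsSelfAdjoint b → b ∈ f.range := by
    intro b hb
    obtain ⟨r, -, hr1, hr2⟩ := exists_resolvent_mem (S := ⊤) isClosed_univ hb trivial
    obtain ⟨g, hg, hgr⟩ := exists_mem_graph_resolvent π₁ π₂ hE hτ hχc G hGc hG hGt hd hb hr1
    have hrf : r ∈ f.range := ⟨⟨g, hg⟩, hgr⟩
    have h3 := mem_of_mul_eq_one hcl hrf hr2 hr1
    rw [← add_sub_cancel_right b (Complex.I • (1 : A))]
    exact sub_mem h3 (f.range.smul_mem (one_mem _) _)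
  have h : a ∈ f.range := by
    rw [← realPart_add_I_smul_imaginaryPart a]
    exact add_mem (key _ (realPart a).2) (f.range.smul_mem (key _ (imaginaryPart a).2) _)
  obtain ⟨g, hg⟩ := h
  exact ⟨g, g.2, hg⟩

/-- The functional `(a, b) ↦ τ a + χ b` on the product; its `2`-seminorm controls those of both
coordinates. -/
def prodTrace (τ : A →ₗ[ℂ] ℂ) (χ : B →ₗ[ℂ] ℂ) : A × B →ₗ[ℂ] ℂ := τ.coprod χ

theorem isPositiveTrace_prodTrace (hτ : IsPositiveTrace τ) (hχ : IsPositiveTrace χ) :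
    IsPositiveTrace (prodTrace τ χ) where
  nonneg x := by
    open scoped ComplexOrder in exact add_nonneg (hτ.nonneg x.1) (hχ.nonneg x.2)
  tracial x y := congrArg₂ (· + ·) (hτ.tracial x.1 y.1) (hχ.tracial x.2 y.2)

theorem traceNorm_prodTrace_sq (hτ : IsPositiveTrace τ) (hχ : IsPositiveTrace χ) (x : A × B) :
    traceNorm (prodTrace τ χ) x ^ 2 = traceNorm τ x.1 ^ 2 + traceNorm χ x.2 ^ 2 := by
  have h := (isPositiveTrace_prodTrace hτ hχ).apply_star_mul_self x
  have h' : prodTrace τ χ (star x * x) = τ (star x.1 * x.1) + χ (star x.2 * x.2) := rfl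
  rw [h', hτ.apply_star_mul_self, hχ.apply_star_mul_self] at h
  exact_mod_cast h.symm

/-- Two C⋆-algebras with faithful traces whose unit balls are complete in the `2`-norm are
isomorphic as soon as dense star subalgebras of them are: the star subalgebra `P` of the product
is the graph of the given isomorphism, and the `2`-norm closure of `P` is the graph of its
extension. -/
theorem exists_starAlgEquiv_of_dense (hτ : IsPositiveTrace τ) (hχ : IsPositiveTrace χ)
    (hτf : ∀ x, τ (star x * x) = 0 → x = 0) (hχf : ∀ x, χ (star x * x) = 0 → x = 0)
    (hτc : IsTraceComplete τ) (hχc : IsTraceComplete χ) (P : StarSubalgebra ℂ (A × B))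
    (hP : ∀ p ∈ P, τ p.1 = χ p.2)
    (hd₁ : ∀ a, ∀ ε > 0, ∃ p ∈ P, traceNorm τ (a - p.1) < ε)
    (hd₂ : ∀ b, ∀ ε > 0, ∃ p ∈ P, traceNorm χ (b - p.2) < ε) :
    ∃ φ : A ≃⋆ₐ[ℂ] B, (∀ p ∈ P, φ p.1 = p.2) ∧ ∀ x, χ (φ x) = τ x := by
  have hT := isPositiveTrace_prodTrace hτ hχ
  set G := traceClosure hT P with hGdef
  let π₁ : A × B →⋆ₐ[ℂ] A := StarAlgHom.fst ℂ A B
  let π₂ : A × B →⋆ₐ[ℂ] B := StarAlgHom.snd ℂ A B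
  have hle₁ : ∀ x : A × B, traceNorm τ x.1 ≤ traceNorm (prodTrace τ χ) x := fun x => by
    have := traceNorm_prodTrace_sq hτ hχ x
    exact le_of_sq_le_sq (by nlinarith) (IsPositiveTrace.traceNorm_nonneg _ _)
  have hle₂ : ∀ x : A × B, traceNorm χ x.2 ≤ traceNorm (prodTrace τ χ) x := fun x => by
    have := traceNorm_prodTrace_sq hτ hχ x
    exact le_of_sq_le_sq (by nlinarith) (IsPositiveTrace.traceNorm_nonneg _ _)
  have hle : ∀ x : A × B, traceNorm (prodTrace τ χ) x ≤ traceNorm τ x.1 + traceNorm χ x.2 :=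
    fun x => by
      have := traceNorm_prodTrace_sq hτ hχ x
      have h1 := IsPositiveTrace.traceNorm_nonneg τ x.1
      have h2 := IsPositiveTrace.traceNorm_nonneg χ x.2
      exact le_of_sq_le_sq (by nlinarith) (by positivity)
  have hG : ∀ g ∈ G, τ g.1 = χ g.2 := by
    intro g hg
    rw [← sub_eq_zero, ← norm_le_zero_iff]
    refine le_of_forall_pos_le_add fun ε hε => ?_
    have c1 := IsPositiveTrace.traceNorm_nonneg τ 1
    have c2 := IsPositiveTrace.traceNorm_nonneg χ 1
    obtain ⟨p, hp, h⟩ := hg (ε / (traceNorm τ 1 + traceNorm χ 1 + 1)) (by positivity)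
    rw [lt_div_iff₀ (by positivity)] at h
    have h1 : τ g.1 - χ g.2 = τ (g - p).1 - χ (g - p).2 := by
      simp [hP p hp]
    rw [h1, zero_add]
    have h2 := norm_sub_le (τ (g - p).1) (χ (g - p).2)
    have h3 := hτ.norm_apply_le (g - p).1
    have h4 := hχ.norm_apply_le (g - p).2
    have h5 := hle₁ (g - p)
    have h6 := hle₂ (g - p)
    have h7 := IsPositiveTrace.traceNorm_nonneg (prodTrace τ χ) (g - p)
    nlinarith
  have hGt : ∀ e : A × B, (∀ ε > 0, ∃ g ∈ G, traceNorm τ (e.1 - g.1) < ε ∧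
      traceNorm χ (e.2 - g.2) < ε) → e ∈ G := by
    intro e he
    refine mem_traceClosure_of_approx hT P fun ε hε => ?_
    obtain ⟨g, hg, h1, h2⟩ := he (ε / 2) (half_pos hε)
    refine ⟨g, hg, (hle _).trans_lt ?_⟩
    simp only [Prod.fst_sub, Prod.snd_sub]
    linarith
  have hinj₁ : ∀ g ∈ G, g.1 = 0 → g = 0 := by
    intro g hg h0
    refine Prod.ext h0 (hχf _ ?_)
    have := hG _ (mul_mem (star_mem hg) hg)
    simpa [h0] using this.symm
  have hinj₂ : ∀ g ∈ G, g.2 = 0 → g = 0 := by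
    intro g hg h0
    refine Prod.ext (hτf _ ?_) h0
    have := hG _ (mul_mem (star_mem hg) hg)
    simpa [h0] using this
  have hGc := isClosed_traceClosure hT P
  have hsurj₁ := exists_mem_graph π₁ π₂ (fun a b => ⟨(a, b), rfl, rfl⟩) hτ hχc G hGc hG hGt
    (fun a ε hε => (hd₁ a ε hε).imp fun p hp => ⟨subset_traceClosure hT P hp.1, hp.2⟩) hinj₁
  have hsurj₂ := exists_mem_graph π₂ π₁ (fun b a => ⟨(a, b), rfl, rfl⟩) hχ hτc G hGc
    (fun g hg => (hG g hg).symm)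
    (fun e he => hGt e fun ε hε => (he ε hε).imp fun g hg => ⟨hg.1, hg.2.2, hg.2.1⟩)
    (fun a ε hε => (hd₂ a ε hε).imp fun p hp => ⟨subset_traceClosure hT P hp.1, hp.2⟩) hinj₂
  let e₁ : G ≃⋆ₐ[ℂ] A := StarAlgEquiv.ofBijective (π₁.comp G.subtype)
    ⟨(injective_iff_map_eq_zero _).mpr fun g hg => Subtype.ext (hinj₁ g g.2 hg),
      fun a => (hsurj₁ a).elim fun g hg => ⟨⟨g, hg.1⟩, hg.2⟩⟩
  let e₂ : G ≃⋆ₐ[ℂ] B := StarAlgEquiv.ofBijective (π₂.comp G.subtype)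
    ⟨(injective_iff_map_eq_zero _).mpr fun g hg => Subtype.ext (hinj₂ g g.2 hg),
      fun a => (hsurj₂ a).elim fun g hg => ⟨⟨g, hg.1⟩, hg.2⟩⟩
  have he₁ : ∀ g : G, e₁ g = (g : A × B).1 := fun g => rfl
  have he₂ : ∀ g : G, e₂ g = (g : A × B).2 := fun g => rfl
  have key : ∀ g : G, (e₁.symm.trans e₂) (g : A × B).1 = (g : A × B).2 := fun g => by
    rw [← he₁, StarAlgEquiv.trans_apply, StarAlgEquiv.symm_apply_apply, he₂]
  refine ⟨e₁.symm.trans e₂, fun p hp => key ⟨p, subset_traceClosure hT P hp⟩, fun x => ?_⟩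
  obtain ⟨g, hg, rfl⟩ := hsurj₁ x
  exact (congrArg χ (key ⟨g, hg⟩)).trans (hG g hg).symm

end Extension

/-! ### Completeness of the unit ball of a von Neumann algebra in the `2`-norm -/

section WeakLimits

open Filter Topology

variable {H : Type*} [NormedAddCommGroup H] [InnerProductSpace ℂ H] [CompleteSpace H]

theorem isClosed_toStarSubalgebra (M : VonNeumannAlgebra H) :
    IsClosed (M.toStarSubalgebra : Set (H →L[ℂ] H)) := by
  rw [VonNeumannAlgebra.coe_toStarSubalgebra, ← M.centralizer_centralizer]
  exact Set.isClosed_centralizer _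

-- A von Neumann algebra is thereby a C⋆-algebra. The instance is local, because it would change how
-- instances are synthesized in statements about the underlying star subalgebra.
attribute [local instance] isClosed_toStarSubalgebra

/-- Norm-bounded sequences of operators converge along ultrafilters in the weak operator
topology. -/
theorem exists_tendsto_inner_of_bounded (U : Ultrafilter ℕ) (x : ℕ → H →L[ℂ] H) (C : ℝ)
    (hx : ∀ n, ‖x n‖ ≤ C) :
    ∃ y : H →L[ℂ] H, ∀ ξ η, Tendsto (fun n => inner ℂ ξ (x n η)) U (𝓝 (inner ℂ ξ (y η))) := by
  have hb : ∀ ξ η n, ‖inner ℂ (x n ξ) η‖ ≤ C * ‖ξ‖ * ‖η‖ := fun ξ η n =>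
    (norm_inner_le_norm _ _).trans (by
      gcongr
      exact (x n).le_of_opNorm_le (hx n) ξ)
  have hlim : ∀ ξ η, ∃ z : ℂ, ‖z‖ ≤ C * ‖ξ‖ * ‖η‖ ∧
      Tendsto (fun n => inner ℂ (x n ξ) η) U (𝓝 z) := by
    intro ξ η
    obtain ⟨z, hz, h⟩ := (isCompact_closedBall (0 : ℂ) (C * ‖ξ‖ * ‖η‖)).ultrafilter_le_nhds
      (U.map fun n => inner ℂ (x n ξ) η) (by
        refine le_principal_iff.mpr (Filter.mem_map.mpr (Filter.univ_mem' fun n => ?_))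
        simpa using hb ξ η n)
    exact ⟨z, by simpa using hz, h⟩
  choose L hL hLt using hlim
  let B : H →L⋆[ℂ] H →L[ℂ] ℂ := LinearMap.mkContinuous₂
    (LinearMap.mk₂'ₛₗ (starRingEnd ℂ) (RingHom.id ℂ) L
      (fun ξ ξ' η => tendsto_nhds_unique (hLt (ξ + ξ') η) (by
        simpa only [map_add, inner_add_left] using (hLt ξ η).add (hLt ξ' η)))
      (fun c ξ η => tendsto_nhds_unique (hLt (c • ξ) η) (by
        simpa only [map_smul, inner_smul_left, smul_eq_mul] using (hLt ξ η).const_mul (starRingEnd ℂ c)))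
      (fun ξ η η' => tendsto_nhds_unique (hLt ξ (η + η')) (by
        simpa only [inner_add_right] using (hLt ξ η).add (hLt ξ η')))
      (fun c ξ η => tendsto_nhds_unique (hLt ξ (c • η)) (by
        simpa only [inner_smul_right, smul_eq_mul, RingHom.id_apply] using (hLt ξ η).const_mul c)))
    C hL
  refine ⟨InnerProductSpace.continuousLinearMapOfBilin B, fun ξ η => ?_⟩
  have h := (Complex.continuous_conj.tendsto _).comp (hLt η ξ)
  have h1 : (starRingEnd ℂ) (L η ξ) =
      inner ℂ ξ (InnerProductSpace.continuousLinearMapOfBilin B η) := by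
    rw [← inner_conj_symm, InnerProductSpace.continuousLinearMapOfBilin_apply]
    rfl
  rw [h1] at h
  exact h.congr fun n => inner_conj_symm _ _

theorem mem_of_tendsto_inner (M : VonNeumannAlgebra H) (U : Filter ℕ) [U.NeBot]
    (x : ℕ → H →L[ℂ] H) (hx : ∀ n, x n ∈ M) (y : H →L[ℂ] H)
    (h : ∀ ξ η, Tendsto (fun n => inner ℂ ξ (x n η)) U (𝓝 (inner ℂ ξ (y η)))) : y ∈ M := by
  rw [← SetLike.mem_coe, ← M.centralizer_centralizer, Set.mem_centralizer_iff]
  intro z hz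
  ext η
  refine ext_inner_left ℂ fun ξ => ?_
  have h1 := h (ContinuousLinearMap.adjoint z ξ) η
  have h2 := h ξ (z η)
  rw [mul_apply_eq_comp, mul_apply_eq_comp]
  rw [ContinuousLinearMap.adjoint_inner_left] at h1
  refine tendsto_nhds_unique h1 (h2.congr fun n => ?_)
  rw [ContinuousLinearMap.adjoint_inner_left]
  have h3 := DFunLike.congr_fun (hz (x n) (hx n)) η
  rw [mul_apply_eq_comp, mul_apply_eq_comp] at h3
  rw [h3]

theorem summable_norm_sq {ι V : Type*} [NormedAddCommGroup V] (f : lp (fun _ : ι => V) 2) : Summable fun n => ‖f n‖ ^ 2 := by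
  have := (lp.memℓp f).summable (by norm_num)
  simpa using this

/-- On norm-bounded sequences, normal functionals are continuous for the weak operator topology. -/
theorem IsNormal.tendsto {M : VonNeumannAlgebra H} {τ : M.toStarSubalgebra →ₗ[ℂ] ℂ}
    (hτ : IsNormal M τ) (U : Filter ℕ) (x : ℕ → M.toStarSubalgebra) (y : M.toStarSubalgebra)
    (C : ℝ) (hx : ∀ n, ‖x n‖ ≤ C)
    (h : ∀ ξ η, Tendsto (fun n => inner ℂ ξ ((x n : H →L[ℂ] H) η)) U
      (𝓝 (inner ℂ ξ ((y : H →L[ℂ] H) η)))) :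
    Tendsto (fun n => τ (x n)) U (𝓝 (τ y)) := by
  let t : TopologicalSpace M.toStarSubalgebra :=
    TopologicalSpace.induced Subtype.val (ultraweakTopology H)
  have hc : @Tendsto _ _ τ (@nhds _ t y) (𝓝 (τ y)) := (@Continuous.tendsto _ _ t _ _ hτ y)
  refine Tendsto.comp hc ?_
  rw [@nhds_induced, @nhds_induced, comap_comap, tendsto_comap_iff, tendsto_pi_nhds]
  intro p
  refine tendsto_tsum_of_dominated_convergence
    (bound := fun k => C * (‖p.1 k‖ ^ 2 + ‖p.2 k‖ ^ 2))
    (((summable_norm_sq p.1).add (summable_norm_sq p.2)).mul_left C) (fun k => h _ _)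
    (Eventually.of_forall fun n k => ?_)
  have h1 : ‖(x n : H →L[ℂ] H) (p.2 k)‖ ≤ C * ‖p.2 k‖ :=
    (x n : H →L[ℂ] H).le_of_opNorm_le (hx n) _
  have h2 := norm_inner_le_norm (𝕜 := ℂ) (p.1 k) ((x n : H →L[ℂ] H) (p.2 k))
  have hC : 0 ≤ C := (norm_nonneg _).trans (hx n)
  refine h2.trans ?_
  have h3 : ‖p.1 k‖ * ‖(x n : H →L[ℂ] H) (p.2 k)‖ ≤ ‖p.1 k‖ * (C * ‖p.2 k‖) := by gcongr
  nlinarith [mul_nonneg hC (sq_nonneg (‖p.1 k‖ - ‖p.2 k‖)), mul_nonneg hC (sq_nonneg ‖p.1 k‖),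
    mul_nonneg hC (sq_nonneg ‖p.2 k‖)]

theorem IsFaithfulNormalTrace.isPositiveTrace {M : VonNeumannAlgebra H}
    {τ : M.toStarSubalgebra →ₗ[ℂ] ℂ} (hτ : IsFaithfulNormalTrace M τ) : IsPositiveTrace τ :=
  ⟨hτ.nonneg, hτ.tracial⟩

/-- The unit ball of a von Neumann algebra with a normal trace is complete for the `2`-norm. The
limit of a Cauchy sequence is taken in the weak operator topology along an ultrafilter; it is a
limit in `2`-norm because the `2`-norm is lower semicontinuous. -/
theorem IsFaithfulNormalTrace.isTraceComplete {M : VonNeumannAlgebra H}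
    {τ : M.toStarSubalgebra →ₗ[ℂ] ℂ} (hτ : IsFaithfulNormalTrace M τ) : IsTraceComplete τ := by
  intro x hx hcauchy
  have hτ' := hτ.isPositiveTrace
  obtain ⟨y₀, hy₀⟩ := exists_tendsto_inner_of_bounded (hyperfilter ℕ) (fun n => (x n : H →L[ℂ] H))
    1 hx
  have hyM : y₀ ∈ M := mem_of_tendsto_inner M _ _ (fun n => (x n).2) y₀ hy₀
  let y : M.toStarSubalgebra := ⟨y₀, hyM⟩
  refine ⟨y, fun ε hε => ?_⟩
  obtain ⟨N, hN⟩ := hcauchy (ε / 2) (half_pos hε)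
  refine ⟨N, fun n hn => ?_⟩
  set w := x n - y with hw
  have hlim : Tendsto (fun m => τ (star w * (x n - x m))) (hyperfilter ℕ : Filter ℕ)
      (𝓝 (τ (star w * w))) := by
    refine hτ.normal.tendsto _ _ _ (‖w‖ * 2) (fun m => ?_) fun ξ η => ?_
    · have h1 := norm_mul_le (star w) (x n - x m)
      rw [norm_star] at h1
      have h2 := norm_sub_le (x n) (x m)
      have h3 := hx n
      have h4 := hx m
      exact h1.trans (by gcongr; linarith)
    · have h1 : ∀ v : M.toStarSubalgebra,
          inner ℂ ξ (((star w * (x n - v) : M.toStarSubalgebra) : H →L[ℂ] H) η) =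
            inner ℂ ((w : H →L[ℂ] H) ξ) ((x n : H →L[ℂ] H) η) -
              inner ℂ ((w : H →L[ℂ] H) ξ) ((v : H →L[ℂ] H) η) := by
        intro v
        rw [← inner_sub_right]
        exact ContinuousLinearMap.adjoint_inner_right (w : H →L[ℂ] H) _ _
      simp only [h1]
      rw [hw, h1]
      exact (hy₀ _ _).const_sub _
  have hev : ∀ᶠ m in (hyperfilter ℕ : Filter ℕ),
      ‖τ (star w * (x n - x m))‖ ≤ traceNorm τ w * (ε / 2) := by
    have h1 : ∀ᶠ m in (hyperfilter ℕ : Filter ℕ), N ≤ m :=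
      Nat.hyperfilter_le_atTop (eventually_ge_atTop N)
    filter_upwards [h1] with m hm
    refine (hτ'.norm_apply_star_mul_le _ _).trans ?_
    have := (hN n hn m hm).le
    have := IsPositiveTrace.traceNorm_nonneg τ w
    gcongr
  have hle := le_of_tendsto hlim.norm hev
  rw [hτ'.apply_star_mul_self, Complex.norm_real, Real.norm_of_nonneg (sq_nonneg _)] at hle
  have h0 := IsPositiveTrace.traceNorm_nonneg τ w
  by_contra! hcon
  nlinarith

end WeakLimits

/-! ### The double commutant theorem and density in the `2`-norm -/

section DoubleCommutant

attribute [local instance] isClosed_toStarSubalgebra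

open Filter Topology

variable {H : Type*} [NormedAddCommGroup H] [InnerProductSpace ℂ H] {ι : Type*}

/-- The diagonal action `a ⊗ 1` of an operator `a` on the Hilbert sum `ℓ²(ι; H)` of copies of
`H`. -/
def ampliation (ι : Type*) (a : H →L[ℂ] H) :
    lp (fun _ : ι => H) 2 →L[ℂ] lp (fun _ : ι => H) 2 :=
  lp.mapCLM 2 (fun _ => a) (norm_nonneg a) fun _ => le_rfl

@[simp]
theorem ampliation_apply (a : H →L[ℂ] H) (f : lp (fun _ : ι => H) 2) (i : ι) :
    ampliation ι a f i = a (f i) := rfl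

theorem ampliation_single [DecidableEq ι] (a : H →L[ℂ] H) (i : ι) (v : H) :
    ampliation ι a (lp.single 2 i v) = lp.single 2 i (a v) := by
  ext j
  rw [ampliation_apply, lp.single_apply, lp.single_apply]
  rcases eq_or_ne j i with rfl | h
  · simp
  · simp [h]

theorem ampliation_sub (a b : H →L[ℂ] H) (f : lp (fun _ : ι => H) 2) :
    ampliation ι (a - b) f = ampliation ι a f - ampliation ι b f := by
  ext; rfl

theorem norm_sq_eq_tsum {V : Type*} [NormedAddCommGroup V] (f : lp (fun _ : ι => V) 2) : ‖f‖ ^ 2 = ∑' i, ‖f i‖ ^ 2 := by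
  have := lp.norm_rpow_eq_tsum (p := 2) (by norm_num) f
  simpa using this

/-- An operator on `ℓ²(ι; H)` that commutes with `a ⊗ 1` for all `a` in a set `S` also commutes
with `x ⊗ 1` for all `x` in the double commutant of `S`: the entries of its operator matrix lie in
the commutant of `S`. -/
theorem ampliation_comm_of_mem_centralizer {S : Set (H →L[ℂ] H)} {x : H →L[ℂ] H}
    (hx : x ∈ Set.centralizer (Set.centralizer S))
    (p : lp (fun _ : ι => H) 2 →L[ℂ] lp (fun _ : ι => H) 2)
    (hp : ∀ a ∈ S, ∀ f, p (ampliation ι a f) = ampliation ι a (p f))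
    (f : lp (fun _ : ι => H) 2) : p (ampliation ι x f) = ampliation ι x (p f) := by
  classical
  suffices h : p.comp (ampliation ι x) = (ampliation ι x).comp p from DFunLike.congr_fun h f
  refine lp.ext_continuousLinearMap (by norm_num) fun j => ?_
  ext v i
  let q : H →L[ℂ] H := (lp.evalCLM ℂ (fun _ : ι => H) 2 i).comp
    (p.comp (lp.singleContinuousLinearMap ℂ (fun _ : ι => H) 2 j))
  have hq : ∀ v, q v = p (lp.single 2 j v) i := fun v => rfl
  have hqS : q ∈ Set.centralizer S := by
    intro a ha
    ext v
    have h1 := hp a ha (lp.single 2 j v)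
    rw [ampliation_single] at h1
    rw [mul_apply_eq_comp, mul_apply_eq_comp, hq, hq, h1, ampliation_apply]
  have h2 := DFunLike.congr_fun (hx q hqS) v
  rw [mul_apply_eq_comp, mul_apply_eq_comp, hq, hq] at h2
  change p (ampliation ι x (lp.single 2 j v)) i = x (p (lp.single 2 j v) i)
  rw [ampliation_single, h2]

variable [CompleteSpace H]

theorem inner_ampliation_star (a : H →L[ℂ] H) (f g : lp (fun _ : ι => H) 2) :
    inner ℂ (ampliation ι (star a) f) g = inner ℂ f (ampliation ι a g) := by
  simp only [lp.inner_eq_tsum, ampliation_apply]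
  exact tsum_congr fun i => ContinuousLinearMap.adjoint_inner_left a _ _

/-- The double commutant theorem for one vector of `ℓ²(ι; H)`. -/
theorem ampliation_mem_closure (S : StarSubalgebra ℂ (H →L[ℂ] H)) {x : H →L[ℂ] H}
    (hx : x ∈ Set.centralizer (Set.centralizer (S : Set (H →L[ℂ] H))))
    (ξ : lp (fun _ : ι => H) 2) :
    ampliation ι x ξ ∈ closure ((fun a => ampliation ι a ξ) '' (S : Set (H →L[ℂ] H))) := by
  let W : Submodule ℂ (lp (fun _ : ι => H) 2) :=
    { carrier := (fun a => ampliation ι a ξ) '' (S : Set (H →L[ℂ] H))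
      add_mem' := by
        rintro _ _ ⟨a, ha, rfl⟩ ⟨b, hb, rfl⟩
        exact ⟨a + b, add_mem ha hb, by ext; rfl⟩
      zero_mem' := ⟨0, zero_mem S, by ext; rfl⟩
      smul_mem' := by
        rintro c _ ⟨a, ha, rfl⟩
        exact ⟨c • a, S.smul_mem ha c, by ext; rfl⟩ }
  let V := W.topologicalClosure
  have hV : ∀ a ∈ S, ∀ v ∈ V, ampliation ι a v ∈ V := by
    intro a ha v hv
    have hmaps : Set.MapsTo (ampliation ι a) (W : Set (lp (fun _ : ι => H) 2)) W := by
      rintro _ ⟨b, hb, rfl⟩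
      exact ⟨a * b, mul_mem ha hb, by ext; rfl⟩
    exact hmaps.closure (ampliation ι a).continuous hv
  have hcomm : ∀ a ∈ (S : Set (H →L[ℂ] H)), ∀ f,
      V.starProjection (ampliation ι a f) = ampliation ι a (V.starProjection f) := by
    intro a ha f
    refine Submodule.eq_starProjection_of_mem_of_inner_eq_zero
      (hV a ha _ (Submodule.starProjection_apply_mem V f)) fun w hw => ?_
    rw [← map_sub, ← star_star a, ← inner_conj_symm, ← inner_ampliation_star, star_star,
      inner_conj_symm]
    exact Submodule.starProjection_inner_eq_zero f _ (hV _ (star_mem ha) w hw)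
  have hξ : ξ ∈ V := W.le_topologicalClosure ⟨1, one_mem S, by ext; rfl⟩
  have h := ampliation_comm_of_mem_centralizer hx V.starProjection hcomm ξ
  rw [Submodule.starProjection_eq_self_iff.mpr hξ] at h
  have h' : ampliation ι x ξ ∈ V := by
    rw [← h]
    exact Submodule.starProjection_apply_mem V _
  exact h'

/-- The double commutant theorem for finitely many vectors of `ℓ²(ℕ; H)`, which are joined to one
vector of `ℓ²(I × ℕ; H)`. -/
theorem exists_ampliation_sub_lt (S : StarSubalgebra ℂ (H →L[ℂ] H)) {x : H →L[ℂ] H}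
    (hx : x ∈ Set.centralizer (Set.centralizer (S : Set (H →L[ℂ] H))))
    {I : Set (lp (fun _ : ℕ => H) 2)} (hI : I.Finite) {ε : ℝ} (hε : 0 < ε) :
    ∃ a ∈ S, ∀ ξ ∈ I, ‖ampliation ℕ a ξ - ampliation ℕ x ξ‖ < ε := by
  have := hI.to_subtype
  let Ξ : lp (fun _ : I × ℕ => H) 2 := ⟨fun i => i.1.1 i.2, memℓp_gen (by
    simp only [ENNReal.toReal_ofNat, Real.rpow_ofNat]
    refine (summable_prod_of_nonneg fun i => by positivity).mpr ⟨fun ξ => summable_norm_sq ξ.1, ?_⟩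
    exact Summable.of_finite)⟩
  obtain ⟨_, ⟨a, ha, rfl⟩, h⟩ := Metric.mem_closure_iff.mp (ampliation_mem_closure S hx Ξ) ε hε
  refine ⟨a, ha, fun ξ hξ => ?_⟩
  rw [dist_comm, dist_eq_norm] at h
  refine lt_of_le_of_lt ?_ h
  rw [← ampliation_sub, ← ampliation_sub]
  refine le_of_sq_le_sq ?_ (norm_nonneg _)
  rw [norm_sq_eq_tsum, norm_sq_eq_tsum]
  exact tsum_comp_le_tsum_of_inj (summable_norm_sq (ampliation (I × ℕ) (a - x) Ξ))
    (fun _ => by positivity) (Prod.mk_right_injective (⟨ξ, hξ⟩ : I))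

/-- A star subalgebra of a von Neumann algebra `M` whose double commutant contains `M` is dense in
`M` for the `2`-norm of every normal trace. -/
theorem IsFaithfulNormalTrace.exists_traceNorm_sub_lt {M : VonNeumannAlgebra H}
    {τ : M.toStarSubalgebra →ₗ[ℂ] ℂ} (hτ : IsFaithfulNormalTrace M τ)
    (P : StarSubalgebra ℂ M.toStarSubalgebra) (x : M.toStarSubalgebra)
    (hx : (x : H →L[ℂ] H) ∈ Set.centralizer (Set.centralizer
      (P.map M.toStarSubalgebra.subtype : Set (H →L[ℂ] H)))) {ε : ℝ} (hε : 0 < ε) :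
    ∃ a ∈ P, traceNorm τ (x - a) < ε := by
  have hτ' := hτ.isPositiveTrace
  let Φ : M.toStarSubalgebra → lp (fun _ : ℕ => H) 2 → lp (fun _ : ℕ => H) 2 :=
    fun z ξ => ampliation ℕ (z : H →L[ℂ] H) ξ
  -- the net of the elements of `P` that approach `x` in the ultrastrong topology
  let l : Filter P := comap (fun a => Φ a) (𝓝 (Φ x))
  have hl : l.NeBot := by
    refine comap_neBot_iff.mpr fun t ht => ?_
    rw [nhds_pi, Filter.mem_pi] at ht
    obtain ⟨I, hI, s, hs, hst⟩ := ht
    choose δ hδ hδs using fun ξ => Metric.mem_nhds_iff.mp (hs ξ)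
    have hsmall : ∀ᶠ e in 𝓝[>] (0 : ℝ), ∀ ξ ∈ I, e < δ ξ :=
      (eventually_all_finite hI).mpr fun ξ _ =>
        nhdsWithin_le_nhds (eventually_lt_nhds (hδ ξ))
    obtain ⟨e, he, he0⟩ := (hsmall.and self_mem_nhdsWithin).exists
    obtain ⟨_, ⟨a, ha, rfl⟩, h⟩ := exists_ampliation_sub_lt _ hx hI (ε := e) he0
    refine ⟨⟨a, ha⟩, hst fun ξ hξ => hδs ξ ?_⟩
    rw [Metric.mem_ball, dist_eq_norm]
    exact (h ξ hξ).trans (he ξ hξ)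
  have hstrong : ∀ ξ : lp (fun _ : ℕ => H) 2,
      Tendsto (fun a : P => ampliation ℕ ((x - a : M.toStarSubalgebra) : H →L[ℂ] H) ξ) l (𝓝 0) := by
    intro ξ
    have h : Tendsto (fun a : P => Φ a) l (𝓝 (Φ x)) := tendsto_comap
    have h1 := (tendsto_pi_nhds.mp h ξ).const_sub (Φ x ξ)
    rw [sub_self] at h1
    exact h1.congr fun a => (ampliation_sub _ _ ξ).symm
  have hlim : Tendsto (fun a : P => τ (star (x - a) * (x - a))) l (𝓝 0) := by
    let t : TopologicalSpace M.toStarSubalgebra :=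
      TopologicalSpace.induced Subtype.val (ultraweakTopology H)
    have hc : @Tendsto _ _ τ (@nhds _ t 0) (𝓝 (τ 0)) :=
      (@Continuous.tendsto _ _ t _ _ hτ.normal 0)
    rw [map_zero] at hc
    refine hc.comp ?_
    rw [@nhds_induced, @nhds_induced, comap_comap, tendsto_comap_iff, tendsto_pi_nhds]
    intro p
    have h1 := (hstrong p.1).inner (𝕜 := ℂ) (hstrong p.2)
    simp only [inner_zero_left] at h1
    simp only [Function.comp_apply, ZeroMemClass.coe_zero, zero_apply, inner_zero_right, tsum_zero]
    refine h1.congr fun a => ?_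
    rw [lp.inner_eq_tsum]
    exact tsum_congr fun n => (ContinuousLinearMap.adjoint_inner_right
      ((x - a : M.toStarSubalgebra) : H →L[ℂ] H) _ _).symm
  have hev := (Metric.tendsto_nhds.mp hlim (ε ^ 2) (by positivity)).exists
  obtain ⟨a, ha⟩ := hev
  refine ⟨a, a.2, ?_⟩
  rw [dist_zero_right, hτ'.apply_star_mul_self, Complex.norm_real,
    Real.norm_of_nonneg (sq_nonneg _)] at ha
  exact lt_of_pow_lt_pow_left₀ 2 hε.le ha

end DoubleCommutant

/-! ### Recovering mixed moments from the distributions of linear pencils -/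

section Polynomial

variable {A B V : Type*} [Ring A] [Algebra ℂ A] [Ring B] [Algebra ℂ B] [AddCommGroup V]
  [Module ℂ V]

theorem exists_polynomial_apply_pow (φ : A →ₗ[ℂ] ℂ) (a b : A) (p : ℕ) :
    ∃ Q : Polynomial ℂ, ∀ z : ℂ, φ ((a + z • b) ^ p) = Q.eval z := by
  induction p generalizing φ with
  | zero => exact ⟨Polynomial.C (φ 1), fun z => by simp⟩
  | succ p ih =>
    obtain ⟨Q, hQ⟩ := ih (φ ∘ₗ LinearMap.mulRight ℂ a)
    obtain ⟨R, hR⟩ := ih (φ ∘ₗ LinearMap.mulRight ℂ b)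
    refine ⟨Q + Polynomial.X * R, fun z => ?_⟩
    simp only [LinearMap.comp_apply, LinearMap.mulRight_apply] at hQ hR
    rw [pow_succ, mul_add, mul_smul_comm, map_add, map_smul, hQ, hR]
    simp

/-- If the `p`-th moments of `S a` and `S' a` agree at infinitely many points `a` of a complex
line, then they agree on the line. -/
theorem moment_eq_on_line (φ : A →ₗ[ℂ] ℂ) (ψ : B →ₗ[ℂ] ℂ) (S : V →ₗ[ℂ] A) (S' : V →ₗ[ℂ] B)
    (p : ℕ) (a b : V) (s : Set ℝ) (hs : s.Infinite)
    (h : ∀ t ∈ s, φ (S (a + (t : ℂ) • b) ^ p) = ψ (S' (a + (t : ℂ) • b) ^ p)) (z : ℂ) :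
    φ (S (a + z • b) ^ p) = ψ (S' (a + z • b) ^ p) := by
  simp only [map_add, map_smul] at h ⊢
  obtain ⟨Q, hQ⟩ := exists_polynomial_apply_pow φ (S a) (S b) p
  obtain ⟨R, hR⟩ := exists_polynomial_apply_pow ψ (S' a) (S' b) p
  simp only [hQ, hR] at h ⊢
  have hQR : Q = R := by
    refine Polynomial.eq_of_infinite_eval_eq Q R
      ((hs.image Complex.ofReal_injective.injOn).mono ?_)
    rintro _ ⟨t, ht, rfl⟩
    exact h t ht
  rw [hQR]

theorem norm_smul_add_smul_add_smul_le {W : Type*} [NormedAddCommGroup W] [NormedSpace ℂ W]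
    {r s t ε C D E : ℝ} (hr : |r| ≤ ε) (hs : |s| ≤ ε) (ht : |t| ≤ ε) {x y z : W} (hx : ‖x‖ ≤ C)
    (hy : ‖y‖ ≤ D) (hz : ‖z‖ ≤ E) :
    ‖(r : ℂ) • x + (s : ℂ) • y + (t : ℂ) • z‖ ≤ ε * (C + D + E) := by
  have hε : 0 ≤ ε := (abs_nonneg r).trans hr
  refine norm_add₃_le.trans ?_
  rw [norm_smul, norm_smul, norm_smul, Complex.norm_real, Complex.norm_real, Complex.norm_real,
    mul_add, mul_add]
  simp only [Real.norm_eq_abs]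
  gcongr

open scoped Matrix.Norms.L2Operator in
theorem spectrum_smul_one_add_subset {n : ℕ} (hn : 1 ≤ n) (m R : ℝ)
    (y : Matrix (Fin n) (Fin n) ℂ) (hy : ‖y‖ ≤ R) :
    spectrum ℝ ((m : ℂ) • (1 : Matrix (Fin n) (Fin n) ℂ) + y) ⊆ Set.Icc (m - R) (m + R) := by
  have : NeZero n := ⟨by omega⟩
  intro r hr
  rw [← spectrum.algebraMap_mem_iff ℂ, ← Algebra.algebraMap_eq_smul_one,
    ← spectrum.singleton_add_eq] at hr
  rw [Set.singleton_add] at hr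
  obtain ⟨w, hw, hwr⟩ := hr
  have h1 := spectrum.norm_le_norm_of_mem hw
  have h2 : w = ((r - m : ℝ) : ℂ) := by
    rw [Complex.ofReal_sub]
    exact eq_sub_of_add_eq' hwr
  rw [h2, Complex.norm_real, Real.norm_eq_abs] at h1
  have h3 := abs_le.mp (h1.trans hy)
  constructor <;> linarith

/-- If the `p`-th moments of the linear pencils `S` and `S'` agree for self-adjoint matrix
coefficients with spectra in a nondegenerate interval, then they agree for all matrix
coefficients. -/
theorem moment_eq_of_spectrum_subset {k n : ℕ} (hn : 1 ≤ n) (φ : A →ₗ[ℂ] ℂ) (ψ : B →ₗ[ℂ] ℂ)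
    (S : (Fin k → Matrix (Fin n) (Fin n) ℂ) →ₗ[ℂ] A)
    (S' : (Fin k → Matrix (Fin n) (Fin n) ℂ) →ₗ[ℂ] B) (p : ℕ) {c d : ℝ} (hcd : c < d)
    (h : ∀ a : Fin k → Matrix (Fin n) (Fin n) ℂ,
      (∀ i, IsSelfAdjoint (a i) ∧ spectrum ℝ (a i) ⊆ Set.Icc c d) →
        φ (S a ^ p) = ψ (S' a ^ p))
    (a : Fin k → Matrix (Fin n) (Fin n) ℂ) : φ (S a ^ p) = ψ (S' a ^ p) := by
  open scoped Matrix.Norms.L2Operator in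
  set b : Fin k → Matrix (Fin n) (Fin n) ℂ := (realPart a).1 with hb
  set e : Fin k → Matrix (Fin n) (Fin n) ℂ := (imaginaryPart a).1 with he
  have hbs : IsSelfAdjoint b := (realPart a).2
  have hes : IsSelfAdjoint e := (imaginaryPart a).2
  have hab : a = b + Complex.I • e := (realPart_add_I_smul_imaginaryPart a).symm
  let m : ℝ := (c + d) / 2
  let ε : ℝ := (d - c) / 2 / (1 + ‖b‖ + ‖e‖)
  have hε : 0 < ε := div_pos (by linarith) (by positivity)
  have hεm : ε * (1 + ‖b‖ + ‖e‖) = (d - c) / 2 := div_mul_cancel₀ _ (by positivity)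
  -- the moments agree in a real neighbourhood of the scalar matrices with entry `(c + d) / 2`
  have h0 : ∀ r ∈ Set.Ioo (-ε) ε, ∀ s ∈ Set.Ioo (-ε) ε, ∀ t ∈ Set.Ioo (-ε) ε,
      φ (S (((m : ℂ) • 1 + (r : ℂ) • 1 + (s : ℂ) • b) + (t : ℂ) • e) ^ p) =
        ψ (S' (((m : ℂ) • 1 + (r : ℂ) • 1 + (s : ℂ) • b) + (t : ℂ) • e) ^ p) := by
    intro r hr s hs t ht
    refine h _ fun i => ⟨?_, ?_⟩
    · have h1 : ∀ x : ℝ, IsSelfAdjoint (x : ℂ) := fun x => Complex.conj_ofReal x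
      have h2 : IsSelfAdjoint (((m : ℂ) • 1 + (r : ℂ) • 1 + (s : ℂ) • b) + (t : ℂ) • e) :=
        ((((h1 m).smul (.one _)).add ((h1 r).smul (.one _))).add ((h1 s).smul hbs)).add
          ((h1 t).smul hes)
      exact congrFun h2 i
    · have h1 : (((m : ℂ) • 1 + (r : ℂ) • 1 + (s : ℂ) • b) + (t : ℂ) • e) i =
          (m : ℂ) • 1 + ((r : ℂ) • 1 + (s : ℂ) • b i + (t : ℂ) • e i) := by
        simp only [Pi.add_apply, Pi.smul_apply, Pi.one_apply]
        abel
      rw [h1]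
      have : NeZero n := ⟨by omega⟩
      have h2 : ‖(r : ℂ) • (1 : Matrix (Fin n) (Fin n) ℂ) + (s : ℂ) • b i + (t : ℂ) • e i‖ ≤
          (d - c) / 2 := by
        rw [← hεm]
        exact norm_smul_add_smul_add_smul_le (abs_lt.mpr hr).le (abs_lt.mpr hs).le
          (abs_lt.mpr ht).le norm_one.le (norm_le_pi_norm b i) (norm_le_pi_norm e i)
      refine (spectrum_smul_one_add_subset hn m _ _ h2).trans (Set.Icc_subset_Icc ?_ ?_)
      · simp only [m]; linarith
      · simp only [m]; linarith
  have hinf : (Set.Ioo (-ε) ε).Infinite := Set.Ioo_infinite (by linarith)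
  -- and therefore, one complex variable after the other, on the complex span
  have h1 : ∀ r ∈ Set.Ioo (-ε) ε, ∀ s ∈ Set.Ioo (-ε) ε, ∀ z : ℂ, _ := fun r hr s hs =>
    moment_eq_on_line φ ψ S S' p _ e _ hinf (h0 r hr s hs)
  have h2 : ∀ r ∈ Set.Ioo (-ε) ε, ∀ w : ℂ, _ := fun r hr =>
    moment_eq_on_line φ ψ S S' p ((m : ℂ) • 1 + (r : ℂ) • 1 + Complex.I • e) b _ hinf
      fun s hs => by
        rw [add_right_comm]
        exact h1 r hr s hs Complex.I
  have h3 := moment_eq_on_line φ ψ S S' p ((m : ℂ) • 1 + Complex.I • e + (1 : ℂ) • b) 1 _ hinf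
    (fun r hr => by
      have h4 : (m : ℂ) • 1 + Complex.I • e + (1 : ℂ) • b + (r : ℂ) • 1 =
        (m : ℂ) • 1 + (r : ℂ) • 1 + Complex.I • e + (1 : ℂ) • b := by abel
      rw [h4]
      exact h2 r hr 1) (-(m : ℂ))
  have h5 : (m : ℂ) • 1 + Complex.I • e + (1 : ℂ) • b + (-(m : ℂ)) • 1 = a := by
    rw [hab]; module
  rwa [h5] at h3

end Polynomial

section CyclicShift

variable {A : Type*} [Ring A]

/-- The product `x j * x (j + 1) * ⋯ * x (j + m - 1)`, with indices modulo `q + 1`. -/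
def cyclicProd {q : ℕ} (x : Fin (q + 1) → A) (j : Fin (q + 1)) (m : ℕ) : A :=
  ((List.range m).map fun l => x (j + l • 1)).prod

theorem cyclicProd_succ {q : ℕ} (x : Fin (q + 1) → A) (j : Fin (q + 1)) (m : ℕ) :
    cyclicProd x j (m + 1) = cyclicProd x j m * x (j + m • 1) := by
  simp [cyclicProd, List.range_succ]

theorem cyclicProd_succ' {q : ℕ} (x : Fin (q + 1) → A) (j : Fin (q + 1)) (m : ℕ) :
    cyclicProd x j (m + 1) = x j * cyclicProd x (j + 1) m := by
  simp only [cyclicProd, List.range_succ_eq_map, List.map_cons, List.prod_cons, zero_smul,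
    add_zero, List.map_map]
  congr 3
  funext l
  simp [succ_nsmul', add_assoc]

theorem val_nsmul_one {q l : ℕ} (hl : l < q + 1) : (l • (1 : Fin (q + 1))).val = l := by
  induction l with
  | zero => simp
  | succ l ih =>
    have h := ih (by omega)
    rw [succ_nsmul, Fin.val_add_one_of_lt', h]
    rw [h]; exact hl

theorem cyclicProd_zero {q : ℕ} (x : Fin (q + 1) → A) :
    cyclicProd x 0 (q + 1) = (List.ofFn x).prod := by
  rw [cyclicProd]
  congr 1
  refine List.ext_getElem (by simp) fun l h1 h2 => ?_
  simp only [List.getElem_map, List.getElem_range, List.getElem_ofFn, zero_add]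
  congr 1
  exact Fin.ext (val_nsmul_one (by simpa using h1))

theorem add_card_nsmul_one {q : ℕ} (j : Fin (q + 1)) : j + (q + 1) • 1 = j := by
  have : (q + 1) • (1 : Fin (q + 1)) = 0 := by
    simpa using card_nsmul_eq_zero (G := Fin (q + 1)) (x := 1)
  rw [this, add_zero]

variable [Algebra ℂ A]

/-- The weighted cyclic shift `∑ⱼ e_{j,j+1} ⊗ x j`. -/
def cyclicShift {q : ℕ} (x : Fin (q + 1) → A) :
    Matrix (Fin (q + 1)) (Fin (q + 1)) ℂ ⊗[ℂ] A :=
  ∑ j, Matrix.single j (j + 1) (1 : ℂ) ⊗ₜ[ℂ] x j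

theorem cyclicShift_pow {q : ℕ} (x : Fin (q + 1) → A) (m : ℕ) :
    cyclicShift x ^ m = ∑ j, Matrix.single j (j + m • 1) (1 : ℂ) ⊗ₜ[ℂ] cyclicProd x j m := by
  induction m with
  | zero =>
    simp only [pow_zero, cyclicProd, List.range_zero, List.map_nil, List.prod_nil, zero_smul,
      add_zero]
    rw [← TensorProduct.sum_tmul, Matrix.sum_single_one]
    rfl
  | succ m ih =>
    rw [pow_succ, ih, cyclicShift, Finset.sum_mul_sum]
    refine Finset.sum_congr rfl fun j _ => ?_
    rw [Finset.sum_eq_single (j + m • 1)]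
    · rw [Algebra.TensorProduct.tmul_mul_tmul, Matrix.single_mul_single_same, mul_one,
        cyclicProd_succ, succ_nsmul, add_assoc]
    · intro i _ hi
      rw [Algebra.TensorProduct.tmul_mul_tmul, Matrix.single_mul_single_of_ne _ _ _ _ hi.symm,
        TensorProduct.zero_tmul]
    · simp

/-- The moment of order `q + 1` of the weighted cyclic shift is the trace of the product of its
weights: the power is diagonal, and its entries are the cyclic rotations of this product. -/
theorem trTensor_cyclicShift_pow {q : ℕ} (τ : A →ₗ[ℂ] ℂ) (hτ : ∀ x y, τ (x * y) = τ (y * x))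
    (x : Fin (q + 1) → A) :
    trTensor (q + 1) τ (cyclicShift x ^ (q + 1)) = τ (List.ofFn x).prod := by
  have hrot : ∀ j, τ (cyclicProd x j (q + 1)) = τ (List.ofFn x).prod := by
    intro j
    induction j using Fin.induction with
    | zero => rw [cyclicProd_zero]
    | succ j ih =>
      rw [← ih, ← Fin.coeSucc_eq_succ, cyclicProd_succ, cyclicProd_succ', hτ]
      congr 3
      have := add_card_nsmul_one j.castSucc
      rw [succ_nsmul', ← add_assoc] at this
      exact this
  rw [cyclicShift_pow, map_sum]
  have hterm : ∀ j : Fin (q + 1), trTensor (q + 1) τ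
      (Matrix.single j (j + (q + 1) • 1) (1 : ℂ) ⊗ₜ[ℂ] cyclicProd x j (q + 1)) =
        ((q + 1 : ℕ) : ℂ)⁻¹ * τ (List.ofFn x).prod := by
    intro j
    rw [add_card_nsmul_one]
    simp [trTensor, normTr, hrot]
  rw [Finset.sum_congr rfl fun j _ => hterm j]
  have : ((q + 1 : ℕ) : ℂ) ≠ 0 := by exact_mod_cast Nat.succ_ne_zero q
  rw [Finset.sum_const, Finset.card_univ, Fintype.card_fin, nsmul_eq_mul, ← mul_assoc,
    mul_inv_cancel₀ this, one_mul]

theorem cyclicShift_eq_sum {q k : ℕ} (X : Fin k → A) (w : Fin (q + 1) → Fin k) :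
    cyclicShift (fun j => X (w j)) =
      ∑ i, (∑ j with w j = i, Matrix.single j (j + 1) (1 : ℂ)) ⊗ₜ[ℂ] X i := by
  simp only [TensorProduct.sum_tmul]
  rw [cyclicShift, ← Finset.sum_fiberwise (g := w)]
  refine Finset.sum_congr rfl fun i _ => Finset.sum_congr rfl fun j hj => ?_
  rw [(Finset.mem_filter.mp hj).2]

end CyclicShift

section Moments

variable {A B : Type*} [Ring A] [Algebra ℂ A] [Ring B] [Algebra ℂ B]

/-- The linear pencil `a ↦ ∑ᵢ aᵢ ⊗ Xᵢ`. -/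
def pencil {k : ℕ} (n : ℕ) (X : Fin k → A) :
    (Fin k → Matrix (Fin n) (Fin n) ℂ) →ₗ[ℂ] Matrix (Fin n) (Fin n) ℂ ⊗[ℂ] A :=
  ∑ i, (TensorProduct.mk ℂ _ A).flip (X i) ∘ₗ LinearMap.proj i

theorem pencil_apply {k n : ℕ} (X : Fin k → A) (a : Fin k → Matrix (Fin n) (Fin n) ℂ) :
    pencil n X a = ∑ i, a i ⊗ₜ[ℂ] X i := by
  simp [pencil]

/-- Equality of the distributions of all linear pencils, with coefficients whose spectra lie in a
nondegenerate interval, gives equality of all mixed moments. -/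
theorem trace_word_eq {k : ℕ} (τ : A →ₗ[ℂ] ℂ) (χ : B →ₗ[ℂ] ℂ)
    (hτ : ∀ x y, τ (x * y) = τ (y * x)) (hχ : ∀ x y, χ (x * y) = χ (y * x))
    (h1 : τ 1 = χ 1) (X : Fin k → A) (Y : Fin k → B) {c d : ℝ} (hcd : c < d)
    (hdist : ∀ n : ℕ, 1 ≤ n → ∀ a : Fin k → Matrix (Fin n) (Fin n) ℂ,
      (∀ i, IsSelfAdjoint (a i) ∧ spectrum ℝ (a i) ⊆ Set.Icc c d) →
      distribution (trTensor n τ) (∑ i, a i ⊗ₜ[ℂ] X i) =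
        distribution (trTensor n χ) (∑ i, a i ⊗ₜ[ℂ] Y i))
    (L : List (Fin k)) : τ (L.map X).prod = χ (L.map Y).prod := by
  obtain ⟨p, w, rfl⟩ : ∃ p, ∃ w : Fin p → Fin k, L = List.ofFn w :=
    ⟨L.length, L.get, (List.ofFn_get L).symm⟩
  rw [List.map_ofFn, List.map_ofFn]
  cases p with
  | zero => simpa using h1
  | succ q =>
    have h2 := moment_eq_of_spectrum_subset (Nat.le_add_left 1 q) (trTensor (q + 1) τ)
      (trTensor (q + 1) χ) (pencil (q + 1) X) (pencil (q + 1) Y) (q + 1) hcd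
      (fun a ha => by
        have := congrArg (fun f => f (Polynomial.X ^ (q + 1))) (hdist (q + 1) (by omega) a ha)
        simpa [distribution, pencil_apply] using this)
      (fun i => ∑ j with w j = i, Matrix.single j (j + 1) (1 : ℂ))
    rw [pencil_apply, pencil_apply, ← cyclicShift_eq_sum, ← cyclicShift_eq_sum,
      trTensor_cyclicShift_pow τ hτ, trTensor_cyclicShift_pow χ hχ] at h2
    exact h2

end Moments

/-! ### Star subalgebras containing generators -/

section Generation

attribute [local instance] isClosed_toStarSubalgebra

variable {H : Type*} [NormedAddCommGroup H] [InnerProductSpace ℂ H] [CompleteSpace H]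

/-- A von Neumann algebra is contained in the double commutant of each star subalgebra that
contains its generators. -/
theorem IsGeneratedBy.mem_centralizer_centralizer {M : VonNeumannAlgebra H} {ι : Type*}
    {X : ι → M.toStarSubalgebra} (hX : IsGeneratedBy M X) (S : StarSubalgebra ℂ (H →L[ℂ] H))
    (hS : ∀ i, (X i : H →L[ℂ] H) ∈ S) (x : M.toStarSubalgebra) :
    (x : H →L[ℂ] H) ∈ Set.centralizer (Set.centralizer (S : Set (H →L[ℂ] H))) := by
  have hSS : (StarSubalgebra.centralizer ℂ (StarSubalgebra.centralizer ℂ (S : Set (H →L[ℂ] H)) :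
      Set (H →L[ℂ] H)) : Set (H →L[ℂ] H)) =
        Set.centralizer (Set.centralizer (S : Set (H →L[ℂ] H))) := by
    rw [StarSubalgebra.coe_centralizer_centralizer, StarMemClass.star_coe_eq, Set.union_self]
  let T : VonNeumannAlgebra H :=
    ⟨StarSubalgebra.centralizer ℂ (StarSubalgebra.centralizer ℂ (S : Set (H →L[ℂ] H)) :
      Set (H →L[ℂ] H)), by
        change Set.centralizer (Set.centralizer (StarSubalgebra.centralizer ℂ
          (StarSubalgebra.centralizer ℂ (S : Set (H →L[ℂ] H)) : Set (H →L[ℂ] H)) :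
            Set (H →L[ℂ] H))) = (StarSubalgebra.centralizer ℂ (StarSubalgebra.centralizer ℂ
              (S : Set (H →L[ℂ] H)) : Set (H →L[ℂ] H)) : Set (H →L[ℂ] H))
        rw [hSS, Set.centralizer_centralizer_centralizer]⟩
  have hT : (T : Set (H →L[ℂ] H)) =
      Set.centralizer (Set.centralizer (S : Set (H →L[ℂ] H))) := hSS
  have hMT : M ≤ T := hX.2 fun i => by
    rw [← SetLike.mem_coe, hT]
    exact Set.subset_centralizer_centralizer (hS i)
  rw [← hT]
  exact hMT x.2

/-- A star subalgebra that contains generators of `M` is dense in `M` for the `2`-norm. -/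
theorem IsGeneratedBy.exists_traceNorm_sub_lt {M : VonNeumannAlgebra H}
    {τ : M.toStarSubalgebra →ₗ[ℂ] ℂ} (hτ : IsFaithfulNormalTrace M τ) {ι : Type*}
    {X : ι → M.toStarSubalgebra} (hX : IsGeneratedBy M X) (P : StarSubalgebra ℂ M.toStarSubalgebra)
    (hP : ∀ i, X i ∈ P) (x : M.toStarSubalgebra) {ε : ℝ} (hε : 0 < ε) :
    ∃ a ∈ P, traceNorm τ (x - a) < ε :=
  hτ.exists_traceNorm_sub_lt P x
    (hX.mem_centralizer_centralizer _
      (fun i => StarSubalgebra.mem_map.mpr ⟨X i, hP i, rfl⟩) x) hε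

end Generation

/-- Functionals whose mixed moments in self-adjoint elements `X i` and `Y i` agree, agree on the
star subalgebra of the product that is generated by the pairs
`(X i, Y i)`. -/
theorem apply_fst_eq_apply_snd_of_mem_adjoin {A B ι : Type*} [CStarAlgebra A] [CStarAlgebra B]
    {τ : A →ₗ[ℂ] ℂ} {χ : B →ₗ[ℂ] ℂ} {X : ι → A} {Y : ι → B}
    (hX : ∀ i, IsSelfAdjoint (X i)) (hY : ∀ i, IsSelfAdjoint (Y i))
    (h : ∀ L : List ι, τ (L.map X).prod = χ (L.map Y).prod) {p : A × B}
    (hp : p ∈ StarAlgebra.adjoin ℂ (Set.range fun i => (X i, Y i))) : τ p.1 = χ p.2 := by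
  have hstar : star (Set.range fun i => (X i, Y i)) = Set.range fun i => (X i, Y i) := by
    rw [← Set.image_star, ← Set.range_comp]
    congr 1
    funext i
    exact Prod.ext (hX i) (hY i)
  have hp' : p ∈ Submodule.span ℂ (Submonoid.closure (Set.range fun i => (X i, Y i)) :
      Set (A × B)) := by
    rw [← Algebra.adjoin_eq_span, Subalgebra.mem_toSubmodule]
    rw [← StarSubalgebra.mem_toSubalgebra, StarAlgebra.adjoin_toSubalgebra, hstar,
      Set.union_self] at hp
    exact hp
  clear hp
  induction hp' using Submodule.span_induction with
  | mem p hp =>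
    rw [SetLike.mem_coe, ← FreeMonoid.mrange_lift] at hp
    obtain ⟨L, rfl⟩ := hp
    have h1 : ((FreeMonoid.lift fun i => (X i, Y i)) L).1 = (L.toList.map X).prod := by
      rw [FreeMonoid.lift_apply, ← MonoidHom.coe_fst, map_list_prod, List.map_map]
      rfl
    have h2 : ((FreeMonoid.lift fun i => (X i, Y i)) L).2 = (L.toList.map Y).prod := by
      rw [FreeMonoid.lift_apply, ← MonoidHom.coe_snd, map_list_prod, List.map_map]
      rfl
    rw [h1, h2, h]
  | zero => simp
  | add x y _ _ hx hy => simp [hx, hy]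
  | smul c x _ hx => simp [hx]

end

end FiniteVN

theorem theorem2p1 {H : Type*} [NormedAddCommGroup H] [InnerProductSpace ℂ H] [CompleteSpace H]
    {K : Type*} [NormedAddCommGroup K] [InnerProductSpace ℂ K] [CompleteSpace K]
    (M : VonNeumannAlgebra H) (N : VonNeumannAlgebra K)
    (τ : M.toStarSubalgebra →ₗ[ℂ] ℂ) (hτ : FiniteVN.IsFaithfulNormalTrace M τ)
    (χ : N.toStarSubalgebra →ₗ[ℂ] ℂ) (hχ : FiniteVN.IsFaithfulNormalTrace N χ)
    (k : ℕ) (X : Fin k → M.toStarSubalgebra) (Y : Fin k → N.toStarSubalgebra)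
    (hX : ∀ i, IsSelfAdjoint (X i)) (hY : ∀ i, IsSelfAdjoint (Y i))
    (hXM : FiniteVN.IsGeneratedBy M X) (hYN : FiniteVN.IsGeneratedBy N Y)
    (c d : ℝ) (hcd : c < d)
    (hdist : ∀ n : ℕ, 1 ≤ n → ∀ a : Fin k → Matrix (Fin n) (Fin n) ℂ,
      (∀ i, IsSelfAdjoint (a i) ∧ spectrum ℝ (a i) ⊆ Set.Icc c d) →
      FiniteVN.distribution (FiniteVN.trTensor n τ) (∑ i, a i ⊗ₜ[ℂ] X i) =
        FiniteVN.distribution (FiniteVN.trTensor n χ) (∑ i, a i ⊗ₜ[ℂ] Y i)) :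
    ∃ φ : M.toStarSubalgebra ≃⋆ₐ[ℂ] N.toStarSubalgebra,
      (∀ i, φ (X i) = Y i) ∧ ∀ x, χ (φ x) = τ x := by
  have := FiniteVN.isClosed_toStarSubalgebra M
  have := FiniteVN.isClosed_toStarSubalgebra N
  have hword := FiniteVN.trace_word_eq τ χ hτ.tracial hχ.tracial
    (hτ.map_one.trans hχ.map_one.symm) X Y hcd hdist
  let P := StarAlgebra.adjoin ℂ (Set.range fun i => (X i, Y i))
  have hXY : ∀ i, (X i, Y i) ∈ P := fun i => StarAlgebra.subset_adjoin ℂ _ ⟨i, rfl⟩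
  obtain ⟨φ, hφ, hφt⟩ := FiniteVN.exists_starAlgEquiv_of_dense hτ.isPositiveTrace
    hχ.isPositiveTrace hτ.faithful hχ.faithful hτ.isTraceComplete hχ.isTraceComplete P
    (fun p hp => FiniteVN.apply_fst_eq_apply_snd_of_mem_adjoin hX hY hword hp)
    (fun x ε hε => by
      obtain ⟨_, ⟨p, hp, rfl⟩, h⟩ := hXM.exists_traceNorm_sub_lt hτ
        (P.map (StarAlgHom.fst ℂ M.toStarSubalgebra N.toStarSubalgebra))
        (fun i => ⟨_, hXY i, rfl⟩) x hε
      exact ⟨p, hp, h⟩)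
    (fun x ε hε => by
      obtain ⟨_, ⟨p, hp, rfl⟩, h⟩ := hYN.exists_traceNorm_sub_lt hχ
        (P.map (StarAlgHom.snd ℂ M.toStarSubalgebra N.toStarSubalgebra))
        (fun i => ⟨_, hXY i, rfl⟩) x hε
      exact ⟨p, hp, h⟩)
  exact ⟨φ, fun i => hφ _ (hXY i), hφt⟩
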